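/- Let $\Omega\subseteq\mathbb R^n$ be compact, let $f,g:\Omega\to\mathbb R^n$ be Lipschitz continuous vector fields, and let $q$ be an interior point of $\Omega$. *Flows.* $\Phi^f_t(x)$ denotes the value $y(t)$ of the solution of $y'=f(y)$, $y(0)=x$, staying in $\Omega$ between the times $0$ and $t$; it is unique when it exists. Put $$\Psi_t:=\Phi_t^{-g}\circ\Phi_t^{-f}\circ\Phi_t^{g}\circ\Phi_t^{f},\qquad F(\varepsilon):=\Psi_{\sqrt\varepsilon}(q),$$ where $F$ is defined for those $\varepsilon\ge 0$ for which $\Psi_{\sqrt\varepsilon}(q)$ exists; $F$ is regarded as a set-valued map $\mathbb R\rightsquigarrow\mathbb R^n$ (a singleton where defined, empty elsewhere). *Set-valued Lie bracket.* Let $\mathrm{Diff}(f)$, $\mathrm{Diff}(g)$ be the sets of points interior to $\Omega$ at which $f$, respectively $g$, is differentiable, and on $\mathrm{Diff}(f)\cap\mathrm{Diff}(g)$ let $[f,g]:=Dg\cdot f-Df\cdot g$. Then $[f,g]_{set}(q)$ is the closure of the convex hull of the set of all limits $\lim_k\,[f,g](q_k)$ along sequences $q_k\to q$ in $\mathrm{Diff}(f)\cap\mathrm{Diff}(g)$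 for which the limit exists. It is regarded as a subset of $\mathrm{Lin}(\mathbb R,\mathbb R^n)$ by identifying $v\in\mathbb R^n$ with the map $s\mapsto sv$. *Quasi Differential Quotient.* Let $G:\mathbb R^k\rightsquigarrow\mathbb R^m$ be a set-valued map, $(\bar x,\bar y)\in\mathbb R^k\times\mathbb R^m$, $\Lambda\subset\mathrm{Lin}(\mathbb R^k,\mathbb R^m)$ compact and $\Gamma\subseteq\mathbb R^k$. Then $\Lambda$ is a QDQ of $G$ at $(\bar x,\bar y)$ in the direction of $\Gamma$ if there are $\delta^*\in(0,+\infty]$ and a non-decreasing $\rho:[0,\infty)\to[0,\infty)$ with $\lim_{\delta\to0^+}\rho(\delta)=0$ such that for every $\delta\in(0,\delta^*)$ there is a continuous map $(L_\delta,h_\delta):(\bar x+B_\delta)\cap\Gamma\to\mathrm{Lin}(\mathbb R^k,\mathbb R^m)\times\mathbb R^m$ ($B_\delta$ the closed ball of radius $\delta$ centred at $0$) satisfying, for all $x\in(\bar x+B_\delta)\cap\Gamma$, $$d(L_\delta(x),\Lambda)\le\rho(\delta),\qquad |h_\delta(x)|\le\delta\rho(\delta),\qquad \bar y+L_\delta(x)(x-\bar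 x)+h_\delta(x)\in G(x).$$ **Proposition.** The set $[f,g]_{set}(q)$ is a QDQ of $F$ at $(0,q)$ in the direction of $\mathbb R^+=[0,+\infty)$; in particular it is compact. -/

import Mathlib

open Set Filter Topology
open scoped NNReal ENNReal

/-- `Λ` is a *Quasi Differential Quotient* of the set-valued map `F : X ⇝ Y` at `(xbar, ybar)` in
the direction of `Γ`.  The space `Lin(X, Y)` is `X →L[ℝ] Y` with the operator norm (the spaces are
meant to be finite dimensional, where every linear map is continuous).  The distance `d(L, Λ)` is
the extended one, so that it is `+∞` when `Λ` is empty. -/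
def IsQDQ {X Y : Type*} [NormedAddCommGroup X] [NormedSpace ℝ X]
    [NormedAddCommGroup Y] [NormedSpace ℝ Y]
    (F : X → Set Y) (xbar : X) (ybar : Y) (Λ : Set (X →L[ℝ] Y)) (Γ : Set X) : Prop :=
  IsCompact Λ ∧
  ∃ (δs : ℝ≥0∞) (ρ : ℝ≥0 → ℝ≥0),
    0 < δs ∧ Monotone ρ ∧ Tendsto ρ (𝓝[>] 0) (𝓝 0) ∧
    ∀ δ : ℝ≥0, 0 < δ → (δ : ℝ≥0∞) < δs →
      ∃ (L : X → X →L[ℝ] Y) (h : X → Y),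
        ContinuousOn L (Metric.closedBall xbar δ ∩ Γ) ∧
        ContinuousOn h (Metric.closedBall xbar δ ∩ Γ) ∧
        ∀ x ∈ Metric.closedBall xbar (δ : ℝ) ∩ Γ,
          Metric.infEDist (L x) Λ ≤ (ρ δ : ℝ≥0∞) ∧
          ‖h x‖ ≤ (δ : ℝ) * ρ δ ∧
          ybar + L x (x - xbar) + h x ∈ F x

section LieBracket

variable {E : Type*} [NormedAddCommGroup E] [NormedSpace ℝ E]

/-- The set `Diff(f)` of the differentiability points of a vector field `f` on `Ω`.  The values of
`f` outside `Ω` play no role. -/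
def diffPoints (Ω : Set E) (f : E → E) : Set E :=
  {x | x ∈ interior Ω ∧ DifferentiableAt ℝ f x}

/-- The set-valued Lie bracket `[f, g]_set(q)`: the closed convex hull of the set of all limits
of classical brackets `[f, g](u k) = Dg(u k) f(u k) - Df(u k) g(u k)` along sequences `u k → q` of
common differentiability points of `f` and `g`. -/
def setLieBracket (Ω : Set E) (f g : E → E) (q : E) : Set E :=
  closure (convexHull ℝ
    {v : E | ∃ u : ℕ → E, (∀ k, u k ∈ diffPoints Ω f ∩ diffPoints Ω g) ∧
      Tendsto u atTop (𝓝 q) ∧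
      Tendsto (fun k => VectorField.lieBracket ℝ f g (u k)) atTop (𝓝 v)})

/-- The flow `Φ_t^f` of a vector field `f` on `Ω`, as the set of values: `y ∈ flowValues Ω f t x`
if and only if there is a solution `γ` of `γ' = f(γ)`, `γ 0 = x`, defined on the closed interval
between `0` and `t` and staying in `Ω`, such that `γ t = y`.  The set is empty when there is no such
solution, and has at most one element when `f` is Lipschitz on `Ω`. -/
def flowValues (Ω : Set E) (f : E → E) (t : ℝ) (x : E) : Set E :=
  {y | ∃ γ : ℝ → E, γ 0 = x ∧ γ t = y ∧
    ∀ s ∈ uIcc 0 t, γ s ∈ Ω ∧ HasDerivWithinAt γ (f (γ s)) (uIcc 0 t) s}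

/-- The multi-flow `Ψ_t = Φ_t^{-g} ∘ Φ_t^{-f} ∘ Φ_t^g ∘ Φ_t^f`, as a partially defined map. -/
def multiFlow (Ω : Set E) (f g : E → E) (t : ℝ) (x : E) : Set E :=
  {y | ∃ x₁ ∈ flowValues Ω f t x, ∃ x₂ ∈ flowValues Ω g t x₁,
    ∃ x₃ ∈ flowValues Ω (-f) t x₂, y ∈ flowValues Ω (-g) t x₃}

/-- The map `ε ↦ Ψ_{√ε}(q)`, defined for those `ε ≥ 0` for which `Ψ_{√ε}(q)` exists
(the empty value means undefined). -/
def multiFlowSqrt (Ω : Set E) (f g : E → E) (q : E) (ε : ℝ) : Set E :=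
  {y | 0 ≤ ε ∧ y ∈ multiFlow Ω f g (Real.sqrt ε) q}

/-- Flows of Lipschitz fields are single-valued. -/
theorem flowValues_subsingleton {Ω : Set E} {f : E → E} {K : ℝ≥0} (hf : LipschitzOnWith K f Ω)
    {t : ℝ} (ht : 0 ≤ t) (x : E) : (flowValues Ω f t x).Subsingleton := by
  rintro y ⟨γ, h0, rfl, hγ⟩ z ⟨γ', h0', rfl, hγ'⟩
  rw [uIcc_of_le ht] at hγ hγ'
  have key : ∀ s ∈ Ico 0 t, ∀ c : ℝ → E, ∀ v : E, HasDerivWithinAt c v (Icc 0 t) s →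
      HasDerivWithinAt c v (Ici s) s := fun s hs c v h =>
    h.mono_of_mem_nhdsWithin (Icc_mem_nhdsGE_of_mem hs)
  exact ODE_solution_unique_of_mem_Icc_right (v := fun _ => f) (s := fun _ => Ω) (K := K)
    (fun _ _ => hf)
    (fun s hs => (hγ s hs).2.continuousWithinAt)
    (fun s hs => key s hs _ _ (hγ s (Ico_subset_Icc_self hs)).2)
    (fun s hs => (hγ s (Ico_subset_Icc_self hs)).1)
    (fun s hs => (hγ' s hs).2.continuousWithinAt)
    (fun s hs => key s hs _ _ (hγ' s (Ico_subset_Icc_self hs)).2)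
    (fun s hs => (hγ' s (Ico_subset_Icc_self hs)).1)
    (h0.trans h0'.symm) (right_mem_Icc.2 ht)

/-- The map `ε ↦ Ψ_{√ε}(q)` of Lipschitz fields is a (partially defined) single-valued map. -/
theorem multiFlowSqrt_subsingleton {Ω : Set E} {f g : E → E} {K K' : ℝ≥0}
    (hf : LipschitzOnWith K f Ω) (hg : LipschitzOnWith K' g Ω) (q : E) (ε : ℝ) :
    (multiFlowSqrt Ω f g q ε).Subsingleton := by
  rintro y ⟨-, a, ha, b, hb, c, hc, hy⟩ z ⟨-, a', ha', b', hb', c', hc', hz⟩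
  have ht := Real.sqrt_nonneg ε
  have hf' : LipschitzOnWith K (-f) Ω := fun u hu v hv => by
    simpa [edist_neg_neg] using hf hu hv
  have hg' : LipschitzOnWith K' (-g) Ω := fun u hu v hv => by
    simpa [edist_neg_neg] using hg hu hv
  obtain rfl := flowValues_subsingleton hf ht _ ha ha'
  obtain rfl := flowValues_subsingleton hg ht _ hb hb'
  obtain rfl := flowValues_subsingleton hf' ht _ hc hc'
  exact flowValues_subsingleton hg' ht _ hy hz

end LieBracket

/-! ### Local flows and the third-order expansion of the multi-flow. -/

section Flows

variable {E : Type*} [NormedAddCommGroup E] [NormedSpace ℝ E]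

/-! After extending `f` and `g` to globally Lipschitz fields, put `a = f q`, `b = g q`. Up to an
error `O(t ^ 3)`, the displacement of the multi-flow is the circulation of the fields along the
parallelogram with edges `t • a`, `t • b`, and this survives a translation of the parallelogram by a
vector `e` of size at most `t ^ 2` (`exists_norm_multiFlow_sub_le`).

That freedom handles nonsmoothness: a given parallelogram may miss the differentiability points
altogether, but by Rademacher and Fubini some admissible translate meets them almost everywhere
(`exists_norm_le_ae_add`). On it the circulation is the double integral of `Dg a - Df b`, so divided
by `t ^ 2` it is an average, lying in any closed convex set that contains almost all these values
(`circulation_mem`). Near `q` the values are close to classical brackets, hence to the set-valued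
bracket; its thickenings are closed and convex. So the quotients of `F` at `0` approach the bracket
set (`eventually_multiFlow_quotient_mem`).

For a continuous selection this yields a QDQ: the quotient, frozen below `δ ^ 2`, serves as `L_δ`
(`isQDQ_of_eventually_quotient_mem`). -/

theorem flowValues_mono {Ω Ω' : Set E} {f f' : E → E} (hΩ : Ω ⊆ Ω') (hff : EqOn f f' Ω)
    (t : ℝ) (x : E) : flowValues Ω f t x ⊆ flowValues Ω' f' t x := by
  rintro y ⟨γ, h0, ht, hγ⟩
  exact ⟨γ, h0, ht, fun s hs => ⟨hΩ (hγ s hs).1, hff (hγ s hs).1 ▸ (hγ s hs).2⟩⟩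

/-- Carries trajectories of the extended fields in a small ball back to the original fields on `Ω`.
-/
theorem multiFlow_mono {Ω Ω' : Set E} {f f' g g' : E → E} (hΩ : Ω ⊆ Ω') (hff : EqOn f f' Ω)
    (hgg : EqOn g g' Ω) (t : ℝ) (x : E) : multiFlow Ω f g t x ⊆ multiFlow Ω' f' g' t x := by
  rintro y ⟨x₁, h₁, x₂, h₂, x₃, h₃, h₄⟩
  exact ⟨x₁, flowValues_mono hΩ hff _ _ h₁, x₂, flowValues_mono hΩ hgg _ _ h₂,
    x₃, flowValues_mono hΩ (fun z hz => by simp [hff hz]) _ _ h₃,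
    flowValues_mono hΩ (fun z hz => by simp [hgg hz]) _ _ h₄⟩

/-- A Lipschitz vector field has a continuous local flow on a ball, which stays in the ball of
twice the radius. -/
theorem exists_local_flow [CompleteSpace E] {f : E → E} {K : ℝ≥0} (hf : LipschitzWith K f) (q : E)
    {r : ℝ} (hr : 0 < r) :
    ∃ T > 0, ∃ φ : E × ℝ → E, ContinuousOn φ (Metric.closedBall q r ×ˢ Icc 0 T) ∧
      ∀ x ∈ Metric.closedBall q r, ∀ t ∈ Icc 0 T,
        φ (x, t) ∈ flowValues (Metric.closedBall q (2 * r)) f t x ∧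
        φ (x, t) ∈ Metric.closedBall q (2 * r) := by
  set M : ℝ := ‖f q‖ + K * (2 * r) with hM
  have hM0 : 0 ≤ M := by positivity
  have hfM : ∀ x ∈ Metric.closedBall q (2 * r), ‖f x‖ ≤ M := fun x hx => by
    have h1 := hf.dist_le_mul x q
    have h2 : (K : ℝ) * dist x q ≤ K * (2 * r) := by gcongr; exact hx
    rw [dist_eq_norm] at h1
    have h3 := norm_le_norm_sub_add (f x) (f q)
    linarith
  set T : ℝ := r / (M + 1) with hT
  have hT0 : 0 < T := by positivity
  have hMT : (M + 1) * T = r := by rw [hT]; field_simp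
  have hPL : IsPicardLindelof (fun _ : ℝ => f) (tmin := 0) (tmax := T) ⟨0, left_mem_Icc.2 hT0.le⟩ q
      (2 * r).toNNReal r.toNNReal M.toNNReal K := by
    refine .of_time_independent ?_ hf.lipschitzOnWith ?_
    · rw [Real.coe_toNNReal (2 * r) (by positivity), Real.coe_toNNReal _ hM0]; exact hfM
    · rw [Real.coe_toNNReal (2 * r) (by positivity), Real.coe_toNNReal _ hM0,
        Real.coe_toNNReal _ hr.le]
      simp only [sub_zero, sub_self, max_eq_left hT0.le]
      nlinarith
  obtain ⟨φ, hφ, hc⟩ := hPL.exists_forall_mem_closedBall_eq_hasDerivWithinAt_continuousOn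
  rw [Real.coe_toNNReal _ hr.le] at hφ hc
  refine ⟨T, hT0, φ, hc, fun x hx => ?_⟩
  obtain ⟨h0, hd⟩ := hφ x hx
  have hxq : ‖x - q‖ ≤ r := by simpa [dist_eq_norm] using hx
  have hmem : ∀ s ∈ Icc 0 T, φ (x, s) ∈ Metric.closedBall q (2 * r) := by
    -- Barrier argument: since `(M + 1) * T = r`, a curve touching the barrier is still in the ball
    -- of radius `2 * r`. Its speed there is at most `M`, strictly below the slope `M + 1`.
    have key := image_norm_le_of_norm_deriv_right_lt_deriv_boundary (a := 0) (b := T)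
      (f := fun s => φ (x, s) - q) (f' := fun s => f (φ (x, s)))
      (B := fun s => r + (M + 1) * s) (B' := fun _ => M + 1)
      (fun s hs => (hd s hs).continuousWithinAt.sub continuousWithinAt_const)
      (fun s hs => ((hd s (Ico_subset_Icc_self hs)).sub_const q).mono_of_mem_nhdsWithin
        (Icc_mem_nhdsGE_of_mem hs))
      (by simpa [h0] using hxq)
      (fun s => by simpa using ((hasDerivAt_id s).const_mul (M + 1)).const_add r)
      (fun s hs h => by
        refine (hfM _ ?_).trans_lt (lt_add_one M)
        rw [mem_closedBall_iff_norm, h]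
        nlinarith [hs.1, hs.2])
    intro s hs
    rw [mem_closedBall_iff_norm]
    refine (key hs).trans ?_
    nlinarith [hs.1, hs.2]
  intro t ht
  refine ⟨⟨fun s => φ (x, s), h0, rfl, fun s hs => ?_⟩, hmem t ht⟩
  rw [uIcc_of_le ht.1] at hs ⊢
  have hs' : s ∈ Icc 0 T := ⟨hs.1, hs.2.trans ht.2⟩
  exact ⟨hmem s hs', (hd s hs').mono (Icc_subset_Icc_right ht.2)⟩

/-- The multi-flow of Lipschitz fields has a continuous selection in time. -/
theorem exists_continuousOn_multiFlow [CompleteSpace E] {f g : E → E} {K : ℝ≥0}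
    (hf : LipschitzWith K f) (hg : LipschitzWith K g) (q : E) {R : ℝ} (hR : 0 < R) :
    ∃ T > 0, ∃ P : ℝ → E, ContinuousOn P (Icc 0 T) ∧
      ∀ t ∈ Icc 0 T, P t ∈ multiFlow (Metric.closedBall q R) f g t q := by
  have hsub : ∀ {r}, r ≤ R → ∀ (f : E → E) t x,
      flowValues (Metric.closedBall q r) f t x ⊆ flowValues (Metric.closedBall q R) f t x :=
    fun h f t x => flowValues_mono (Metric.closedBall_subset_closedBall h) (fun _ _ => rfl) t x
  -- Each of the four flows doubles the radius, whence `R / 16`.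
  obtain ⟨T₁, hT₁, φ₁, hc₁, h₁⟩ := exists_local_flow hf q (r := R / 16) (by positivity)
  obtain ⟨T₂, hT₂, φ₂, hc₂, h₂⟩ := exists_local_flow hg q (r := 2 * (R / 16)) (by positivity)
  obtain ⟨T₃, hT₃, φ₃, hc₃, h₃⟩ := exists_local_flow hf.neg q (r := 2 * (2 * (R / 16)))
    (by positivity)
  obtain ⟨T₄, hT₄, φ₄, hc₄, h₄⟩ := exists_local_flow hg.neg q (r := 2 * (2 * (2 * (R / 16))))
    (by positivity)
  set T := min (min T₁ T₂) (min T₃ T₄) with hT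
  have i₁ : Icc 0 T ⊆ Icc 0 T₁ := Icc_subset_Icc_right (by simp [hT])
  have i₂ : Icc 0 T ⊆ Icc 0 T₂ := Icc_subset_Icc_right (by simp [hT])
  have i₃ : Icc 0 T ⊆ Icc 0 T₃ := Icc_subset_Icc_right (by simp [hT])
  have i₄ : Icc 0 T ⊆ Icc 0 T₄ := Icc_subset_Icc_right (by simp [hT])
  let x₁ : ℝ → E := fun t => φ₁ (q, t)
  let x₂ : ℝ → E := fun t => φ₂ (x₁ t, t)
  let x₃ : ℝ → E := fun t => φ₃ (x₂ t, t)
  let x₄ : ℝ → E := fun t => φ₄ (x₃ t, t)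
  have m₀ : q ∈ Metric.closedBall q (R / 16) := Metric.mem_closedBall_self (by positivity)
  have m₁ : ∀ t ∈ Icc 0 T, _ := fun t ht => h₁ q m₀ t (i₁ ht)
  have m₂ : ∀ t ∈ Icc 0 T, _ := fun t ht => h₂ (x₁ t) (m₁ t ht).2 t (i₂ ht)
  have m₃ : ∀ t ∈ Icc 0 T, _ := fun t ht => h₃ (x₂ t) (m₂ t ht).2 t (i₃ ht)
  have m₄ : ∀ t ∈ Icc 0 T, _ := fun t ht => h₄ (x₃ t) (m₃ t ht).2 t (i₄ ht)
  have c₁ : ContinuousOn x₁ (Icc 0 T) :=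
    hc₁.comp (by fun_prop) (fun t ht => ⟨m₀, i₁ ht⟩)
  have c₂ : ContinuousOn x₂ (Icc 0 T) :=
    hc₂.comp (c₁.prodMk continuousOn_id) (fun t ht => ⟨(m₁ t ht).2, i₂ ht⟩)
  have c₃ : ContinuousOn x₃ (Icc 0 T) :=
    hc₃.comp (c₂.prodMk continuousOn_id) (fun t ht => ⟨(m₂ t ht).2, i₃ ht⟩)
  have c₄ : ContinuousOn x₄ (Icc 0 T) :=
    hc₄.comp (c₃.prodMk continuousOn_id) (fun t ht => ⟨(m₃ t ht).2, i₄ ht⟩)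
  refine ⟨T, by positivity, x₄, c₄, fun t ht => ⟨x₁ t, ?_, x₂ t, ?_, x₃ t, ?_, ?_⟩⟩
  · exact hsub (by linarith) _ _ _ (m₁ t ht).1
  · exact hsub (by linarith) _ _ _ (m₂ t ht).1
  · exact hsub (by linarith) _ _ _ (m₃ t ht).1
  · exact hsub (by linarith) _ _ _ (m₄ t ht).1

/-- First and second order expansions of the flow of a Lipschitz field: at second order the curve
may be replaced by a nearby straight line. -/
theorem flowValues_expansion [CompleteSpace E] {S : Set E} {f : E → E} {K : ℝ≥0} {M t : ℝ}
    {x y : E}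
    (hf : LipschitzWith K f) (hM : ∀ z ∈ S, ‖f z‖ ≤ M) (ht : 0 ≤ t)
    (hy : y ∈ flowValues S f t x) :
    ‖y - x‖ ≤ M * t ∧ ‖y - x - t • f x‖ ≤ K * M * t ^ 2 ∧
    ∀ (A : ℝ) (z u : E), ‖x - z‖ ≤ A * t ^ 2 → ‖f x - u‖ ≤ A * t →
      ‖y - x - ∫ s in (0 : ℝ)..t, f (z + s • u)‖ ≤ K * (K * M + 2 * A) * t ^ 3 := by
  obtain ⟨γ, rfl, rfl, hγ⟩ := hy
  rw [uIcc_of_le ht] at hγ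
  have hM0 : 0 ≤ M := (norm_nonneg _).trans (hM _ (hγ 0 ⟨le_rfl, ht⟩).1)
  have e₁ : ∀ s ∈ Icc 0 t, ‖γ s - γ 0‖ ≤ M * t := fun s hs => by
    refine (norm_image_sub_le_of_norm_deriv_le_segment' (fun r hr => (hγ r hr).2)
      (fun r hr => hM _ (hγ r (Ico_subset_Icc_self hr)).1) s hs).trans ?_
    rw [sub_zero]; gcongr; exact hs.2
  have e₂ : ∀ s ∈ Icc 0 t, ‖γ s - γ 0 - s • f (γ 0)‖ ≤ K * M * t ^ 2 := fun s hs => by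
    have := norm_image_sub_le_of_norm_deriv_le_segment' (f := fun s => γ s - s • f (γ 0))
      (f' := fun s => f (γ s) - f (γ 0)) (C := K * (M * t))
      (fun r hr => by
        simpa using (hγ r hr).2.fun_sub ((hasDerivWithinAt_id r _).smul_const (f (γ 0))))
      (fun r hr => by
        refine (hf.norm_sub_le _ _).trans ?_
        gcongr
        exact e₁ r (Ico_subset_Icc_self hr)) s hs
    simp only [zero_smul, sub_zero] at this
    rw [sub_right_comm]
    refine this.trans ?_
    calc K * (M * t) * s ≤ K * (M * t) * t := by gcongr; exact hs.2
      _ = _ := by ring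
  refine ⟨e₁ t ⟨ht, le_rfl⟩, e₂ t ⟨ht, le_rfl⟩, fun A z u hz hu => ?_⟩
  have hA : 0 ≤ A * t := (norm_nonneg _).trans hu
  have hcont : Continuous fun s : ℝ => f (z + s • u) := hf.continuous.comp (by fun_prop)
  -- The gap between curve and line has three parts: the curvature `K * M * t ^ 2`, the offset `A *
  -- t ^ 2` of the base points, and the drift `t * (A * t)` from the directions.
  have := norm_image_sub_le_of_norm_deriv_le_segment'
    (f := fun s => γ s - ∫ r in (0 : ℝ)..s, f (z + r • u))
    (f' := fun s => f (γ s) - f (z + s • u)) (C := K * (K * M + 2 * A) * t ^ 2)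
    (fun r hr => (hγ r hr).2.sub
      (hcont.integral_hasStrictDerivAt 0 r).hasDerivAt.hasDerivWithinAt)
    (fun r hr => by
      refine (hf.norm_sub_le _ _).trans ?_
      rw [mul_assoc]
      gcongr
      have h₁ : γ r - (z + r • u) =
          (γ r - γ 0 - r • f (γ 0)) + (γ 0 - z) + r • (f (γ 0) - u) := by
        rw [smul_sub]; abel
      have h₂ : ‖r • (f (γ 0) - u)‖ ≤ t * (A * t) := by
        rw [norm_smul, Real.norm_of_nonneg hr.1]
        gcongr
        exact hr.2.le
      rw [h₁]
      refine (norm_add₃_le).trans ?_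
      linarith [e₂ r (Ico_subset_Icc_self hr)]) t ⟨ht, le_rfl⟩
  simp only [intervalIntegral.integral_same, sub_zero] at this
  rw [sub_right_comm]
  refine this.trans (le_of_eq (by ring))

/-- The multi-flow equals, up to third order, the circulation of the fields along a parallelogram,
which may be translated by a second order vector `e`. -/
theorem exists_norm_multiFlow_sub_le [CompleteSpace E] {S : Set E} {f g : E → E} {K : ℝ≥0} {M : ℝ}
    (hf : LipschitzWith K f) (hg : LipschitzWith K g) (hfM : ∀ z ∈ S, ‖f z‖ ≤ M)
    (hgM : ∀ z ∈ S, ‖g z‖ ≤ M) (hM : 0 ≤ M) (q : E) :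
    ∃ C : ℝ, ∀ t, 0 ≤ t → ∀ y ∈ multiFlow S f g t q, ∀ e : E, ‖e‖ ≤ t ^ 2 →
      ‖y - q - ((∫ s in (0 : ℝ)..t, g (q + e + t • f q + s • g q) - g (q + e + s • g q)) -
        ∫ s in (0 : ℝ)..t, f (q + e + s • f q + t • g q) - f (q + e + s • f q))‖ ≤ C * t ^ 3 := by
  -- The four starting points are off the vertices by at most 0, 1, 3, 6 times `K * M * t ^ 2`, the
  -- velocities by at most 0, 1, 2, 3 times `K * M * t`. The summand 1 pays for `e`.
  set A : ℝ := 6 * (K * M) + 1 with hA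
  have hKM : 0 ≤ K * M := by positivity
  refine ⟨4 * (K * (K * M + 2 * A)), ?_⟩
  rintro t ht y ⟨x₁, h₁, x₂, h₂, x₃, h₃, h₄⟩ e he
  obtain ⟨n₁, d₁, l₁⟩ := flowValues_expansion hf hfM ht h₁
  obtain ⟨n₂, d₂, l₂⟩ := flowValues_expansion hg hgM ht h₂
  obtain ⟨n₃, d₃, l₃⟩ := flowValues_expansion hf.neg (fun z hz => by simpa using hfM z hz) ht h₃
  obtain ⟨n₄, d₄, l₄⟩ := flowValues_expansion hg.neg (fun z hz => by simpa using hgM z hz) ht h₄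
  simp only [Pi.neg_apply, smul_neg, sub_neg_eq_add] at d₃ l₃ l₄
  have ht2 : 0 ≤ t ^ 2 := by positivity
  have hKMt : 0 ≤ K * M * t := by positivity
  have hKMt2 : 0 ≤ K * M * t ^ 2 := by positivity
  have v₁ : ‖g x₁ - g q‖ ≤ K * M * t := (hg.norm_sub_le _ _).trans (by
    rw [mul_assoc]; gcongr)
  have w₂ : ‖x₂ - q‖ ≤ 2 * (M * t) := by
    have := norm_sub_le_norm_sub_add_norm_sub x₂ x₁ q; linarith
  have w₃ : ‖x₃ - q‖ ≤ 3 * (M * t) := by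
    have := norm_sub_le_norm_sub_add_norm_sub x₃ x₂ q; linarith
  have v₂ : ‖f x₂ - f q‖ ≤ 2 * (K * M * t) := (hf.norm_sub_le _ _).trans (by
    calc K * ‖x₂ - q‖ ≤ K * (2 * (M * t)) := by gcongr
      _ = _ := by ring)
  have v₃ : ‖g x₃ - g q‖ ≤ 3 * (K * M * t) := (hg.norm_sub_le _ _).trans (by
    calc K * ‖x₃ - q‖ ≤ K * (3 * (M * t)) := by gcongr
      _ = _ := by ring)
  have tv : ∀ {v : E} {c : ℝ}, ‖v‖ ≤ c * (K * M * t) → ‖t • v‖ ≤ c * (K * M * t ^ 2) := by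
    intro v c h
    rw [norm_smul, Real.norm_of_nonneg ht]
    calc t * ‖v‖ ≤ t * (c * (K * M * t)) := by gcongr
      _ = _ := by ring
  have z₂ : ‖x₂ - q - t • f q - t • g q‖ ≤ 3 * (K * M * t ^ 2) := by
    have : x₂ - q - t • f q - t • g q =
      (x₂ - x₁ - t • g x₁) + (x₁ - q - t • f q) + t • (g x₁ - g q) := by rw [smul_sub]; abel
    rw [this]
    refine norm_add₃_le.trans ?_
    linarith [tv (c := 1) (v := g x₁ - g q) (by linarith)]
  have z₃ : ‖x₃ - q - t • g q‖ ≤ 6 * (K * M * t ^ 2) := by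
    have : x₃ - q - t • g q =
      (x₃ - x₂ + t • f x₂) + (x₂ - q - t • f q - t • g q) - t • (f x₂ - f q) := by
      rw [smul_sub]; abel
    rw [this]
    refine (norm_sub_le _ _).trans ?_
    have := norm_add_le (x₃ - x₂ + t • f x₂) (x₂ - q - t • f q - t • g q)
    linarith [tv v₂]
  have sub_e : ∀ {v : E}, ‖v‖ ≤ 6 * (K * M * t ^ 2) → ‖v - e‖ ≤ A * t ^ 2 := fun {v} h => by
    refine (norm_sub_le _ _).trans ?_
    rw [hA]; linarith
  -- Each arc is replaced by the corresponding edge of the translated parallelogram.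
  have r₁ := l₁ A (q + e) (f q) (by
    have := sub_e (v := 0) (by simpa using hKMt2)
    rwa [zero_sub, ← sub_add_cancel_left q e] at this) (by simpa using by positivity)
  have r₂ := l₂ A (q + e + t • f q) (g q) (by
    have := sub_e (v := x₁ - q - t • f q) (by linarith)
    convert this using 2; abel) (by rw [hA]; linarith)
  have r₃ := l₃ A (q + e + t • g q + t • f q) (-f q) (by
    have := sub_e (v := x₂ - q - t • f q - t • g q) (by linarith)
    convert this using 2; abel) (by
      rw [sub_neg_eq_add, neg_add_eq_sub, norm_sub_rev, hA]; linarith)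
  have r₄ := l₄ A (q + e + t • g q) (-g q) (by
    have := sub_e (v := x₃ - q - t • g q) (by linarith)
    convert this using 2; abel) (by
      rw [sub_neg_eq_add, neg_add_eq_sub, norm_sub_rev, hA]; linarith)
  -- The two return edges are reversed by `s ↦ t - s`, to be paired with the opposite edges.
  have s₃ : ∫ s in (0 : ℝ)..t, -f (q + e + t • g q + t • f q + s • -f q) =
      -∫ s in (0 : ℝ)..t, f (q + e + s • f q + t • g q) := by
    rw [intervalIntegral.integral_neg]
    have := intervalIntegral.integral_comp_sub_left (a := 0) (b := t)
      (fun s => f (q + e + s • f q + t • g q)) t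
    rw [sub_self, sub_zero] at this
    rw [← this]
    congr 2 with s
    congr 1
    rw [sub_smul, smul_neg]; abel
  have s₄ : ∫ s in (0 : ℝ)..t, -g (q + e + t • g q + s • -g q) =
      -∫ s in (0 : ℝ)..t, g (q + e + s • g q) := by
    rw [intervalIntegral.integral_neg]
    have := intervalIntegral.integral_comp_sub_left (a := 0) (b := t)
      (fun s => g (q + e + s • g q)) t
    rw [sub_self, sub_zero] at this
    rw [← this]
    congr 2 with s
    congr 1
    rw [sub_smul, smul_neg]; abel
  simp only [smul_neg] at r₃ r₄ s₃ s₄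
  rw [s₃] at r₃
  rw [s₄] at r₄
  have hint : ∀ {k : E → E}, LipschitzWith K k → ∀ u v : E,
      IntervalIntegrable (fun s : ℝ => k (u + s • v)) MeasureTheory.volume 0 t := fun hk u v =>
    Continuous.intervalIntegrable (hk.continuous.comp (by fun_prop)) _ _
  have hint' : IntervalIntegrable (fun s : ℝ => f (q + e + s • f q + t • g q))
      MeasureTheory.volume 0 t :=
    Continuous.intervalIntegrable (hf.continuous.comp (by fun_prop)) _ _
  rw [intervalIntegral.integral_sub (hint hg _ _) (hint hg _ _),
    intervalIntegral.integral_sub hint' (hint hf _ _)]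
  set I₁ := ∫ s in (0 : ℝ)..t, f (q + e + s • f q)
  set I₂ := ∫ s in (0 : ℝ)..t, g (q + e + t • f q + s • g q)
  set I₃ := ∫ s in (0 : ℝ)..t, f (q + e + s • f q + t • g q)
  set I₄ := ∫ s in (0 : ℝ)..t, g (q + e + s • g q)
  have : y - q - (I₂ - I₄ - (I₃ - I₁)) =
      (x₁ - q - I₁) + (x₂ - x₁ - I₂) + (x₃ - x₂ - -I₃) + (y - x₃ - -I₄) := by abel
  rw [this]
  refine norm_add₄_le.trans ?_
  linarith

end Flows

/-! ### Circulation as a double integral of derivatives. -/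

section Circulation

open MeasureTheory

variable {E : Type*} [NormedAddCommGroup E] [NormedSpace ℝ E] [FiniteDimensional ℝ E]
  [MeasurableSpace E] [BorelSpace E]

/-- A Lipschitz map is the integral of its derivative along any segment consisting almost
everywhere of differentiability points. -/
theorem LipschitzWith.integral_fderiv_segment {h : E → E} {K : ℝ≥0} (hh : LipschitzWith K h)
    (x v : E) (t : ℝ) (hd : ∀ᵐ r : ℝ, DifferentiableAt ℝ h (x + r • v)) :
    ∫ r in (0 : ℝ)..t, fderiv ℝ h (x + r • v) v = h (x + t • v) - h x := by
  have hint : IntervalIntegrable (fun r : ℝ => fderiv ℝ h (x + r • v) v) volume 0 t := by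
    refine (intervalIntegrable_const (c := K * ‖v‖)).mono_fun ?_ (.of_forall fun r => ?_)
    · exact ((measurable_fderiv_apply_const ℝ h v).comp
        (by fun_prop : Measurable fun r : ℝ => x + r • v)).aestronglyMeasurable
    · rw [Real.norm_of_nonneg (by positivity)]
      exact (ContinuousLinearMap.le_opNorm _ _).trans
        (mul_le_mul_of_nonneg_right (norm_fderiv_le_of_lipschitz ℝ hh) (norm_nonneg _))
  -- Tested against a functional, the restriction to the segment is a real Lipschitz function, hence
  -- absolutely continuous, and the fundamental theorem of calculus applies.
  refine (SeparatingDual.eq_iff_forall_dual_eq (R := ℝ)).2 fun ℓ => ?_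
  rw [← ContinuousLinearMap.intervalIntegral_comp_comm ℓ hint]
  have hline : LipschitzWith ‖v‖₊ fun r : ℝ => x + r • v :=
    LipschitzWith.of_dist_le_mul fun r s => by
      rw [dist_add_left, dist_eq_norm, ← sub_smul, norm_smul, mul_comm, Real.dist_eq,
        coe_nnnorm, Real.norm_eq_abs]
  have hL := ((ℓ.lipschitz.comp hh).comp hline).lipschitzOnWith (s := uIcc 0 t)
  have key := hL.absolutelyContinuousOnInterval.integral_deriv_eq_sub
  simp only [Function.comp_apply, zero_smul, add_zero] at key
  rw [map_sub, ← key]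
  refine intervalIntegral.integral_congr_ae (hd.mono fun r hr _ => ?_)
  have h₁ : HasDerivAt (fun r : ℝ => x + r • v) v r := by
    simpa using ((hasDerivAt_id r).smul_const v).const_add x
  exact (ℓ.hasFDerivAt.comp_hasDerivAt r (hr.hasFDerivAt.comp_hasDerivAt r h₁)).deriv.symm

/-- A measurable property which holds almost everywhere holds almost everywhere on a suitable
arbitrarily small translate of a given parametrized surface. -/
theorem exists_norm_le_ae_add {p : E → Prop} (hpm : MeasurableSet {x | p x})
    (hp : ∀ᵐ x ∂(Measure.addHaar : Measure E), p x) {c : ℝ × ℝ → E} (hc : Measurable c)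
    {η : ℝ} (hη : 0 < η) : ∃ e : E, ‖e‖ ≤ η ∧ ∀ᵐ z : ℝ × ℝ, p (e + c z) := by
  -- For each fixed `z` translation invariance gives almost every `e`. Fubini exchanges the
  -- quantifiers, and a ball of positive measure contains a good `e`.
  have h₁ : ∀ᵐ z : ℝ × ℝ, ∀ᵐ e ∂(Measure.addHaar : Measure E), p (e + c z) :=
    .of_forall fun z => (measurePreserving_add_right _ (c z)).quasiMeasurePreserving.ae hp
  rw [Measure.ae_ae_comm (p := fun z e => p (e + c z))
    (hpm.preimage (by fun_prop : Measurable fun w : (ℝ × ℝ) × E => w.2 + c w.1))] at h₁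
  have h₂ : (Measure.addHaar : Measure E) (Metric.closedBall 0 η) ≠ 0 :=
    (Metric.measure_closedBall_pos _ _ hη).ne'
  obtain ⟨e, he, hpe⟩ := (frequently_ae_mem_iff.2 h₂).and_eventually h₁ |>.exists
  exact ⟨e, by simpa using he, hpe⟩

/-- The circulation of two Lipschitz fields along a small parallelogram, divided by `t ^ 2`, lies
in every closed convex set containing almost all the values `Dg a - Df b` on the parallelogram. -/
theorem circulation_mem {f g : E → E} {K : ℝ≥0} (hf : LipschitzWith K f) (hg : LipschitzWith K g)
    (x a b : E) {t : ℝ} (ht : 0 < t) {C : Set E} (hC : Convex ℝ C) (hCc : IsClosed C)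
    (hdf : ∀ᵐ z : ℝ × ℝ, DifferentiableAt ℝ f (x + (z.1 • a + z.2 • b)))
    (hdg : ∀ᵐ z : ℝ × ℝ, DifferentiableAt ℝ g (x + (z.1 • a + z.2 • b)))
    (hmem : ∀ᵐ z : ℝ × ℝ, z ∈ Ioc 0 t ×ˢ Ioc 0 t →
      fderiv ℝ g (x + (z.1 • a + z.2 • b)) a - fderiv ℝ f (x + (z.1 • a + z.2 • b)) b ∈ C) :
    (t ^ 2)⁻¹ • ((∫ s in (0 : ℝ)..t, g (x + t • a + s • b) - g (x + s • b)) -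
        ∫ s in (0 : ℝ)..t, f (x + s • a + t • b) - f (x + s • a)) ∈ C := by
  have hvol : (volume : Measure (ℝ × ℝ)) (Ioc 0 t ×ˢ Ioc 0 t) = ENNReal.ofReal (t ^ 2) := by
    rw [Measure.volume_eq_prod, Measure.prod_prod, Real.volume_Ioc, sub_zero,
      ← ENNReal.ofReal_mul ht.le, sq]
  have hint : ∀ {h : E → E}, LipschitzWith K h → ∀ v : E,
      IntegrableOn (fun z : ℝ × ℝ => fderiv ℝ h (x + (z.1 • a + z.2 • b)) v)
        (Ioc 0 t ×ˢ Ioc 0 t) := fun {h} hh v => by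
    refine Measure.integrableOn_of_bounded (M := K * ‖v‖) (by simp [hvol]) ?_ ?_
    · exact ((measurable_fderiv_apply_const ℝ h v).comp
        (by fun_prop : Measurable fun z : ℝ × ℝ => x + (z.1 • a + z.2 • b))).aestronglyMeasurable
    · exact .of_forall fun z => (ContinuousLinearMap.le_opNorm _ _).trans
        (by gcongr; exact norm_fderiv_le_of_lipschitz ℝ hh)
  have hg' : ∫ s in (0 : ℝ)..t, g (x + t • a + s • b) - g (x + s • b) =
      ∫ z in Ioc 0 t ×ˢ Ioc 0 t, fderiv ℝ g (x + (z.1 • a + z.2 • b)) a := by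
    -- For `g` the inner integration must run along `a`, the direction of its derivative; hence the
    -- swap, not needed for `f`.
    rw [Measure.volume_eq_prod, ← setIntegral_prod_swap, setIntegral_prod,
      intervalIntegral.integral_of_le ht.le]
    · have hs : ∀ᵐ s : ℝ, ∀ᵐ r : ℝ, DifferentiableAt ℝ g (x + (r • a + s • b)) := by
        have := Measure.ae_ae_of_ae_prod
          ((Measure.measurePreserving_swap (μ := (volume : Measure ℝ))
            (ν := (volume : Measure ℝ))).quasiMeasurePreserving.ae hdg)
        simpa using this
      refine integral_congr_ae (ae_restrict_of_ae (hs.mono fun s hs => ?_))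
      have := hg.integral_fderiv_segment (x + s • b) a t
        (hs.mono fun r hr => by rwa [add_assoc, add_comm (s • b)])
      rw [intervalIntegral.integral_of_le ht.le] at this
      simp only [Prod.swap]
      rw [add_right_comm x, ← this]
      simp only [add_assoc, add_comm (s • b)]
    · exact (hint hg a).swap
  have hf' : ∫ s in (0 : ℝ)..t, f (x + s • a + t • b) - f (x + s • a) =
      ∫ z in Ioc 0 t ×ˢ Ioc 0 t, fderiv ℝ f (x + (z.1 • a + z.2 • b)) b := by
    rw [Measure.volume_eq_prod, setIntegral_prod _ (hint hf b),
      intervalIntegral.integral_of_le ht.le]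
    have hs : ∀ᵐ s : ℝ, ∀ᵐ r : ℝ, DifferentiableAt ℝ f (x + (s • a + r • b)) :=
      Measure.ae_ae_of_ae_prod hdf
    refine integral_congr_ae (ae_restrict_of_ae (hs.mono fun s hs => ?_))
    have := hf.integral_fderiv_segment (x + s • a) b t (hs.mono fun r hr => by rwa [add_assoc])
    rw [intervalIntegral.integral_of_le ht.le] at this
    simp only
    rw [← this]
    simp only [add_assoc]
  have := hC.set_average_mem hCc (μ := volume) (t := Ioc 0 t ×ˢ Ioc 0 t)
    (by rw [hvol]; simp; positivity) (by simp [hvol])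
    ((ae_restrict_iff' (measurableSet_Ioc.prod measurableSet_Ioc)).2 hmem)
    ((hint hg a).sub (hint hf b))
  rw [setAverage_eq, measureReal_def, hvol, ENNReal.toReal_ofReal (by positivity),
    integral_sub (hint hg a) (hint hf b)] at this
  rwa [hg', hf']

end Circulation

theorem Metric.mem_cthickening_add_of_norm_sub_le {E : Type*} [NormedAddCommGroup E]
    {s : Set E} {x y : E} {ε η : ℝ} (hε : 0 ≤ ε)
    (hη : 0 ≤ η) (hx : x ∈ Metric.cthickening ε s) (hxy : ‖y - x‖ ≤ η) :
    y ∈ Metric.cthickening (ε + η) s := by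
  rw [Metric.mem_cthickening_iff] at hx ⊢
  rw [add_comm, ENNReal.ofReal_add hη hε]
  refine Metric.infEDist_le_edist_add_infEDist.trans (add_le_add ?_ hx)
  rw [edist_dist, dist_eq_norm]
  exact ENNReal.ofReal_le_ofReal hxy

/-! ### The set-valued bracket and the difference quotients. -/

section Bracket

variable {E : Type*} [NormedAddCommGroup E] [NormedSpace ℝ E]

/-- Only points interior to `Ω` enter, and there equality on `Ω` is equality of germs, so
derivatives agree. This permits global extensions. -/
theorem setLieBracket_congr {Ω : Set E} {f f' g g' : E → E} (hf : EqOn f f' Ω) (hg : EqOn g g' Ω)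
    (q : E) : setLieBracket Ω f g q = setLieBracket Ω f' g' q := by
  have ev : ∀ {k k' : E → E}, EqOn k k' Ω → ∀ x ∈ interior Ω, k =ᶠ[𝓝 x] k' := fun h x hx =>
    h.eventuallyEq_of_mem (mem_interior_iff_mem_nhds.1 hx)
  have hd : ∀ {k k' : E → E}, EqOn k k' Ω → diffPoints Ω k = diffPoints Ω k' := fun h => by
    ext x
    exact and_congr_right fun hx => (ev h x hx).differentiableAt_iff
  unfold setLieBracket
  rw [hd hf, hd hg]
  congr 3 with v
  refine exists_congr fun u => and_congr_right fun hu => and_congr_right fun _ => ?_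
  refine tendsto_congr fun k => ?_
  have hk := (hu k).1.1
  simp only [VectorField.lieBracket, (ev hf _ hk).fderiv_eq, (ev hg _ hk).fderiv_eq,
    hf (interior_subset hk), hg (interior_subset hk)]

theorem norm_lieBracket_le {f g : E → E} {K : ℝ≥0} (hf : LipschitzWith K f)
    (hg : LipschitzWith K g) (z : E) :
    ‖VectorField.lieBracket ℝ f g z‖ ≤ K * ‖f z‖ + K * ‖g z‖ := by
  refine (norm_sub_le _ _).trans (add_le_add ?_ ?_)
  · exact (ContinuousLinearMap.le_opNorm _ _).trans
      (mul_le_mul_of_nonneg_right (norm_fderiv_le_of_lipschitz ℝ hg) (norm_nonneg _))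
  · exact (ContinuousLinearMap.le_opNorm _ _).trans
      (mul_le_mul_of_nonneg_right (norm_fderiv_le_of_lipschitz ℝ hf) (norm_nonneg _))

theorem isCompact_setLieBracket [FiniteDimensional ℝ E] (Ω : Set E) {f g : E → E} {K : ℝ≥0}
    (hf : LipschitzWith K f) (hg : LipschitzWith K g) (q : E) :
    IsCompact (setLieBracket Ω f g q) := by
  have := FiniteDimensional.proper ℝ E
  refine Bornology.IsBounded.isCompact_closure (isBounded_convexHull.2 ?_)
  refine (Metric.isBounded_closedBall (x := (0 : E)) (r := K * ‖f q‖ + K * ‖g q‖)).subset ?_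
  rintro v ⟨u, -, hu, hv⟩
  rw [mem_closedBall_zero_iff]
  have hlim : Tendsto (fun k => K * ‖f (u k)‖ + K * ‖g (u k)‖) atTop
      (𝓝 (K * ‖f q‖ + K * ‖g q‖)) :=
    (((hf.continuous.tendsto q).comp hu).norm.const_mul _).add
      (((hg.continuous.tendsto q).comp hu).norm.const_mul _)
  exact le_of_tendsto_of_tendsto' hv.norm hlim fun k => norm_lieBracket_le hf hg _

/-- The classical brackets at points near `q` are close to the set-valued bracket at `q`. -/
theorem eventually_lieBracket_mem_cthickening [FiniteDimensional ℝ E] (Ω : Set E) {f g : E → E}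
    {K : ℝ≥0} (hf : LipschitzWith K f) (hg : LipschitzWith K g) (q : E) {ε : ℝ} (hε : 0 < ε) :
    ∀ᶠ z in 𝓝 q, z ∈ diffPoints Ω f ∩ diffPoints Ω g →
      VectorField.lieBracket ℝ f g z ∈ Metric.cthickening ε (setLieBracket Ω f g q) := by
  have := FiniteDimensional.proper ℝ E
  by_contra hcon
  have hfreq : ∃ᶠ z in 𝓝 q, z ∈ diffPoints Ω f ∩ diffPoints Ω g ∧
      VectorField.lieBracket ℝ f g z ∉ Metric.cthickening ε (setLieBracket Ω f g q) := by
    simpa only [Filter.Frequently, not_and, not_not] using hcon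
  obtain ⟨u, huq, hu⟩ := exists_seq_forall_of_frequently hfreq
  have hlim : Tendsto (fun k => K * ‖f (u k)‖ + K * ‖g (u k)‖) atTop
      (𝓝 (K * ‖f q‖ + K * ‖g q‖)) :=
    (((hf.continuous.tendsto q).comp huq).norm.const_mul _).add
      (((hg.continuous.tendsto q).comp huq).norm.const_mul _)
  obtain ⟨B, hB⟩ := hlim.bddAbove_range
  -- The brackets along a bad sequence are bounded, so a subsequence converges; its limit belongs to
  -- the set-valued bracket by definition, a contradiction.
  obtain ⟨v, -, φ, hφ, hv⟩ := tendsto_subseq_of_bounded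
    (Metric.isBounded_closedBall (x := (0 : E)) (r := B))
    (x := fun k => VectorField.lieBracket ℝ f g (u k)) (fun k => by
      rw [mem_closedBall_zero_iff]
      exact (norm_lieBracket_le hf hg _).trans (hB (mem_range_self k)))
  have hvK : v ∈ setLieBracket Ω f g q := subset_closure (subset_convexHull ℝ _
    ⟨u ∘ φ, fun k => (hu _).1, huq.comp hφ.tendsto_atTop, hv⟩)
  obtain ⟨k, hk⟩ := (hv.eventually (Metric.closedBall_mem_nhds v hε)).exists
  exact (hu _).2 (Metric.mem_cthickening_of_dist_le _ v _ _ hvK hk)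

/-- The difference quotients of the multi-flow approach the set-valued bracket. -/
theorem eventually_multiFlow_quotient_mem [FiniteDimensional ℝ E] [MeasurableSpace E]
    [BorelSpace E] {Ω S : Set E} {f g : E → E}
    {K : ℝ≥0} {M : ℝ} (hf : LipschitzWith K f) (hg : LipschitzWith K g)
    (hfM : ∀ z ∈ S, ‖f z‖ ≤ M) (hgM : ∀ z ∈ S, ‖g z‖ ≤ M) {q : E} (hqS : q ∈ S)
    (hq : q ∈ interior Ω) {ε : ℝ} (hε : 0 < ε) :
    ∀ᶠ t in 𝓝[>] (0 : ℝ), ∀ y ∈ multiFlow S f g t q,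
      (t ^ 2)⁻¹ • (y - q) ∈ Metric.cthickening ε (setLieBracket Ω f g q) := by
  have := FiniteDimensional.complete ℝ E
  obtain ⟨C, hC⟩ := exists_norm_multiFlow_sub_le hf hg hfM hgM
    ((norm_nonneg _).trans (hfM q hqS)) q
  set a := f q
  set b := g q
  have hε3 : 0 < ε / 3 := by positivity
  obtain ⟨r, hr, hball⟩ := Metric.eventually_nhds_iff_ball.1
    ((eventually_lieBracket_mem_cthickening Ω hf hg q hε3).and (isOpen_interior.mem_nhds hq))
  -- Bounds the distance from `q` to the points of the translated parallelogram.
  let R : ℝ → ℝ := fun t => t ^ 2 + t * ‖a‖ + t * ‖b‖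
  have ev : ∀ {k : ℝ → ℝ} {c : ℝ}, Continuous k → k 0 < c → ∀ᶠ t in 𝓝[>] (0 : ℝ), k t < c :=
    fun hk h => (hk.continuousAt.eventually_lt_const h).filter_mono nhdsWithin_le_nhds
  filter_upwards [self_mem_nhdsWithin, ev (k := R) (by fun_prop) (by simpa [R] using hr),
    ev (k := fun t => 2 * (K * (K * R t))) (c := ε / 3) (by fun_prop)
      (by simp only [R]; simpa using hε),
    ev (k := fun t => C * t) (c := ε / 3) (by fun_prop) (by simpa using hε)]
    with t (ht : 0 < t) h₁ h₂ h₃ y hy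
  have hmeas : ∀ k : E → E, MeasurableSet {x | DifferentiableAt ℝ k (q + x)} := fun k =>
    (measurableSet_of_differentiableAt ℝ k).preimage (measurable_const_add q)
  have hae : ∀ {k : E → E}, LipschitzWith K k →
      ∀ᵐ x ∂(MeasureTheory.Measure.addHaar : MeasureTheory.Measure E),
        DifferentiableAt ℝ k (q + x) := fun hk =>
    (MeasureTheory.measurePreserving_add_left _ q).quasiMeasurePreserving.ae
      hk.ae_differentiableAt
  obtain ⟨e, he, hde⟩ := exists_norm_le_ae_add
    (p := fun x => DifferentiableAt ℝ f (q + x) ∧ DifferentiableAt ℝ g (q + x))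
    ((hmeas f).inter (hmeas g)) ((hae hf).and (hae hg))
    (c := fun z : ℝ × ℝ => z.1 • a + z.2 • b) (by fun_prop) (η := t ^ 2) (by positivity)
  simp only [← add_assoc q e] at hde
  -- One `ε / 3` is for the distance of nearby brackets to the set, one for replacing `f w`, `g w`
  -- by `a`, `b`; the last absorbs the expansion error `C * t`.
  have hmem := circulation_mem hf hg (q + e) a b ht
    (C := Metric.cthickening (ε / 3 + ε / 3) (setLieBracket Ω f g q))
    ((convex_convexHull ℝ _).closure.cthickening _) Metric.isClosed_cthickening
    (hde.mono fun _ h => h.1) (hde.mono fun _ h => h.2)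
    (hde.mono fun z hz hzt => by
      set w := q + e + (z.1 • a + z.2 • b) with hw
      have hwq : ‖w - q‖ ≤ R t := by
        have : w - q = e + z.1 • a + z.2 • b := by rw [hw]; abel
        rw [this]
        refine norm_add₃_le.trans ?_
        rw [norm_smul, norm_smul, Real.norm_of_nonneg hzt.1.1.le, Real.norm_of_nonneg hzt.2.1.le]
        have := mul_le_mul_of_nonneg_right hzt.1.2 (norm_nonneg a)
        have := mul_le_mul_of_nonneg_right hzt.2.2 (norm_nonneg b)
        simp only [R]; linarith
      obtain ⟨hb₁, hb₂⟩ := hball w (by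
        rw [mem_ball_iff_norm]; exact hwq.trans_lt h₁)
      refine Metric.mem_cthickening_add_of_norm_sub_le hε3.le hε3.le
        (hb₁ ⟨⟨hb₂, hz.1⟩, ⟨hb₂, hz.2⟩⟩) ?_
      have hsplit : fderiv ℝ g w a - fderiv ℝ f w b - VectorField.lieBracket ℝ f g w =
          fderiv ℝ g w (a - f w) - fderiv ℝ f w (b - g w) := by
        rw [VectorField.lieBracket, map_sub, map_sub]; abel
      have hbd : ∀ {k l : E → E}, LipschitzWith K k → LipschitzWith K l →
          ‖fderiv ℝ k w (l q - l w)‖ ≤ K * (K * R t) := fun {k l} hk hl => by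
        refine (ContinuousLinearMap.le_opNorm _ _).trans
          (mul_le_mul (norm_fderiv_le_of_lipschitz ℝ hk) ?_ (norm_nonneg _) K.2)
        refine (hl.norm_sub_le _ _).trans ?_
        rw [norm_sub_rev]
        gcongr
      rw [hsplit]
      refine (norm_sub_le _ _).trans ?_
      linarith [hbd hg hf, hbd hf hg])
  have := Metric.mem_cthickening_add_of_norm_sub_le (y := (t ^ 2)⁻¹ • (y - q)) (by positivity)
    hε3.le hmem (by
      rw [← smul_sub, norm_smul, norm_inv, Real.norm_of_nonneg (by positivity)]
      refine (mul_le_mul_of_nonneg_left (hC t ht.le y hy e he) (by positivity)).trans ?_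
      calc (t ^ 2)⁻¹ * (C * t ^ 3) = C * t := by field_simp
        _ ≤ ε / 3 := h₃.le)
  rwa [add_thirds] at this

end Bracket

/-! ### From difference quotients to a QDQ. -/

/-- A single-valued continuous map whose difference quotients at `0` approach a compact set has
this set as a Quasi Differential Quotient in the direction of the half-line. -/
theorem isQDQ_of_eventually_quotient_mem {E : Type*} [NormedAddCommGroup E] [NormedSpace ℝ E]
    {F : ℝ → Set E} {G : ℝ → E} {Λ : Set E} {T : ℝ} (hT : 0 < T) (hΛ : IsCompact Λ)
    (hG : ContinuousOn G (Icc 0 T)) (hGF : ∀ x ∈ Icc 0 T, G x ∈ F x)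
    (hq : ∀ ε > 0, ∀ᶠ x in 𝓝[>] (0 : ℝ), x⁻¹ • (G x - G 0) ∈ Metric.cthickening ε Λ) :
    IsQDQ F 0 (G 0) ((fun v => ContinuousLinearMap.toSpanSingleton ℝ v) '' Λ) (Ici 0) := by
  set Q : ℝ → E := fun x => x⁻¹ • (G x - G 0) with hQ
  have hiso : Isometry fun v : E => ContinuousLinearMap.toSpanSingleton ℝ v :=
    (ContinuousLinearMap.toSpanSingletonLIE ℝ E).isometry
  obtain ⟨T₁, hT₁, hQ₁⟩ := mem_nhdsGT_iff_exists_Ioo_subset.1 (hq 1 one_pos)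
  obtain ⟨B, hB0, hB⟩ := (hΛ.isBounded.cthickening (δ := 1)).exists_pos_norm_le
  set τ : ℝ := min (min T T₁) 1 with hτ
  have hτ0 : 0 < τ := lt_min (lt_min hT hT₁) one_pos
  have hτT : τ ≤ T := (min_le_left _ _).trans (min_le_left _ _)
  have hτ1 : τ ≤ 1 := min_le_right _ _
  have hQτ : ∀ x ∈ Ioo 0 τ, Q x ∈ Metric.cthickening 1 Λ := fun x hx =>
    hQ₁ ⟨hx.1, hx.2.trans_le ((min_le_left _ _).trans (min_le_right _ _))⟩
  -- The supremum makes the modulus monotone; the cap at `τ` keeps it finite for every `δ`.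
  let S : ℝ≥0 → ℝ≥0∞ := fun δ => ⨆ x ∈ Ioo 0 τ ∩ Iic (δ : ℝ), Metric.infEDist (Q x) Λ
  have hS1 : ∀ δ, S δ ≤ 1 := fun δ => iSup₂_le fun x hx => by
    simpa [Metric.mem_cthickening_iff] using hQτ x hx.1
  have hSmono : Monotone S := fun δ δ' h =>
    biSup_mono fun x hx => ⟨hx.1, (mem_Iic.1 hx.2).trans (NNReal.coe_le_coe.2 h)⟩
  have hStop : ∀ δ, S δ ≠ ∞ := fun δ => ((hS1 δ).trans_lt ENNReal.one_lt_top).ne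
  have hSlim : Tendsto S (𝓝[>] 0) (𝓝 0) := by
    rw [ENNReal.tendsto_nhds_zero]
    intro ε hε
    obtain ⟨ε', hε'0, hε'⟩ := ENNReal.lt_iff_exists_nnreal_btwn.1 hε
    obtain ⟨T₂, hT₂, hQ₂⟩ := mem_nhdsGT_iff_exists_Ioo_subset.1
      (hq ε' (by exact_mod_cast hε'0))
    have : ∀ᶠ δ : ℝ≥0 in 𝓝[>] 0, (δ : ℝ) < T₂ :=
      (NNReal.continuous_coe.continuousAt.eventually_lt_const
        (by simpa using hT₂)).filter_mono nhdsWithin_le_nhds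
    filter_upwards [this] with δ hδ
    refine (iSup₂_le fun x hx => ?_).trans hε'.le
    have := Metric.mem_cthickening_iff.1 (hQ₂ ⟨hx.1.1, (mem_Iic.1 hx.2).trans_lt hδ⟩)
    simpa using this
  let B' : ℝ≥0 := ⟨B, hB0.le⟩
  refine ⟨hΛ.image hiso.continuous, ENNReal.ofReal τ, fun δ => (S δ).toNNReal + 2 * B' * δ,
    by simpa using hτ0, ?_, ?_, ?_⟩
  · intro δ δ' h
    have := ENNReal.toNNReal_mono (hStop δ') (hSmono h)
    dsimp only
    gcongr
  · have h₁ : Tendsto (fun δ => (S δ).toNNReal) (𝓝[>] 0) (𝓝 0) :=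
      (ENNReal.tendsto_toNNReal ENNReal.zero_ne_top).comp hSlim
    have h₂ : Tendsto (fun δ : ℝ≥0 => 2 * B' * δ) (𝓝[>] 0) (𝓝 (2 * B' * 0)) :=
      ((continuous_const.mul continuous_id).tendsto 0).mono_left nhdsWithin_le_nhds
    simpa using h₁.add h₂
  intro δ hδ0 hδ
  replace hδ0 : 0 < (δ : ℝ) := hδ0
  replace hδ : (δ : ℝ) < τ := by
    rw [← ENNReal.ofReal_coe_nnreal] at hδ
    exact (ENNReal.ofReal_lt_ofReal_iff hτ0).1 hδ
  have hδ2 : (δ : ℝ) ^ 2 ≤ δ := by nlinarith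
  have hdom : Metric.closedBall (0 : ℝ) δ ∩ Ici 0 = Icc 0 (δ : ℝ) := by
    ext x
    simp only [mem_inter_iff, mem_closedBall_zero_iff, Real.norm_eq_abs, mem_Ici, mem_Icc]
    exact ⟨fun h => ⟨h.2, (le_abs_self x).trans h.1⟩,
      fun h => ⟨by rw [abs_of_nonneg h.1]; exact h.2, h.1⟩⟩
  rw [hdom]
  -- `Q` need not have a limit at `0`, so it is frozen below `δ ^ 2`. The remainder vanishes above
  -- `δ ^ 2` and is at most `2 * B * δ ^ 2` below, which the term `2 * B' * δ` of the modulus pays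
  -- for.
  let m : ℝ → ℝ := fun x => max x ((δ : ℝ) ^ 2)
  have hm0 : ∀ x, 0 < m x := fun x => lt_max_of_lt_right (by positivity)
  have hmδ : ∀ x ∈ Icc 0 (δ : ℝ), m x ≤ δ := fun x hx => max_le hx.2 hδ2
  have hmτ : ∀ x ∈ Icc 0 (δ : ℝ), m x ∈ Ioo 0 τ := fun x hx =>
    ⟨hm0 x, (hmδ x hx).trans_lt hδ⟩
  have hQm : ContinuousOn (fun x => Q (m x)) (Icc 0 (δ : ℝ)) := by
    have hmc : Continuous m := continuous_id.max continuous_const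
    refine (hmc.continuousOn.inv₀ fun x _ => (hm0 x).ne').smul (ContinuousOn.sub ?_ (by fun_prop))
    exact hG.comp hmc.continuousOn fun x hx => ⟨(hm0 x).le, (hmτ x hx).2.le.trans hτT⟩
  have hGδ : ContinuousOn G (Icc 0 (δ : ℝ)) := hG.mono (Icc_subset_Icc_right (hδ.le.trans hτT))
  refine ⟨fun x => ContinuousLinearMap.toSpanSingleton ℝ (Q (m x)),
    fun x => G x - G 0 - x • Q (m x), hiso.continuous.comp_continuousOn hQm,
    (hGδ.sub continuousOn_const).sub (continuousOn_id.smul hQm), fun x hx => ⟨?_, ?_, ?_⟩⟩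
  · rw [Metric.infEDist_image hiso]
    have : Metric.infEDist (Q (m x)) Λ ≤ S δ :=
      le_biSup (fun x => Metric.infEDist (Q x) Λ) (i := m x) ⟨hmτ x hx, hmδ x hx⟩
    refine this.trans ?_
    rw [ENNReal.coe_add, ENNReal.coe_toNNReal (hStop δ)]
    exact le_self_add
  · have hbound : ‖G x - G 0 - x • Q (m x)‖ ≤ 2 * B * (δ : ℝ) ^ 2 := by
      rcases le_total ((δ : ℝ) ^ 2) x with h | h
      · have hx0 : x ≠ 0 := ((by positivity : (0 : ℝ) < (δ : ℝ) ^ 2).trans_le h).ne'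
        have : G x - G 0 - x • Q (m x) = 0 := by
          simp only [m, max_eq_left h, hQ, smul_inv_smul₀ hx0, sub_self]
        rw [this, norm_zero]
        positivity
      · have hB₁ : ∀ {w : E}, ‖w‖ ≤ B → ‖x • w‖ ≤ B * (δ : ℝ) ^ 2 := fun {w} hw => by
          rw [norm_smul, Real.norm_of_nonneg hx.1, mul_comm]
          exact mul_le_mul hw h hx.1 hB0.le
        have hGx : G x - G 0 = x • Q x := by
          rcases hx.1.eq_or_lt with rfl | hx0
          · simp
          · simp only [hQ, smul_inv_smul₀ hx0.ne']
        have hQx : ‖Q x‖ ≤ B := by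
          rcases hx.1.eq_or_lt with rfl | hx0
          · simpa [hQ] using hB0.le
          · exact hB _ (hQτ x ⟨hx0, hx.2.trans_lt hδ⟩)
        refine (norm_sub_le _ _).trans ?_
        rw [hGx]
        linarith [hB₁ hQx, hB₁ (hB _ (hQτ _ (hmτ x hx)))]
    refine hbound.trans ?_
    have : 0 ≤ (δ : ℝ) * ((S δ).toNNReal : ℝ) := by positivity
    have hρ : (((S δ).toNNReal + 2 * B' * δ : ℝ≥0) : ℝ) = (S δ).toNNReal + 2 * B * δ := rfl
    rw [hρ]
    linarith
  · have : G 0 + ContinuousLinearMap.toSpanSingleton ℝ (Q (m x)) (x - 0) +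
        (G x - G 0 - x • Q (m x)) = G x := by
      rw [ContinuousLinearMap.toSpanSingleton_apply, sub_zero]; abel
    rw [this]
    exact hGF x ⟨hx.1, hx.2.trans (hδ.le.trans hτT)⟩

/-! ### Reduction to global fields and conclusion. -/

theorem proposition5p1 {n : ℕ} {Ω : Set (EuclideanSpace ℝ (Fin n))} (hΩ : IsCompact Ω)
    {f g : EuclideanSpace ℝ (Fin n) → EuclideanSpace ℝ (Fin n)} {Kf Kg : ℝ≥0}
    (hf : LipschitzOnWith Kf f Ω) (hg : LipschitzOnWith Kg g Ω)
    {q : EuclideanSpace ℝ (Fin n)} (hq : q ∈ interior Ω) :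
    IsQDQ (multiFlowSqrt Ω f g q) (0 : ℝ) q
      ((fun v => ContinuousLinearMap.toSpanSingleton ℝ v) '' setLieBracket Ω f g q)
      (Set.Ici 0) := by
  obtain ⟨f', hf', hff⟩ := hf.extend_finite_dimension
  obtain ⟨g', hg', hgg⟩ := hg.extend_finite_dimension
  obtain ⟨K, hfK, hgK⟩ : ∃ K, LipschitzWith K f' ∧ LipschitzWith K g' :=
    ⟨_, hf'.weaken (le_max_left _ _), hg'.weaken (le_max_right _ _)⟩
  obtain ⟨R, hR, hRΩ⟩ := Metric.nhds_basis_closedBall.mem_iff.1 (mem_interior_iff_mem_nhds.1 hq)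
  obtain ⟨Mf, hMf⟩ := hΩ.exists_bound_of_continuousOn hfK.continuous.continuousOn
  obtain ⟨Mg, hMg⟩ := hΩ.exists_bound_of_continuousOn hgK.continuous.continuousOn
  obtain ⟨T, hT, P, hP, hPm⟩ := exists_continuousOn_multiFlow hfK hgK q hR
  rw [setLieBracket_congr hff hgg]
  have hsqrt : ∀ x ∈ Icc 0 (T ^ 2), √x ∈ Icc 0 T := fun x hx =>
    ⟨Real.sqrt_nonneg x, Real.sqrt_le_iff.2 ⟨hT.le, hx.2⟩⟩
  have hP0 : P 0 = q := by
    obtain ⟨x₁, ⟨γ₁, a₁, b₁, -⟩, x₂, ⟨γ₂, a₂, b₂, -⟩, x₃, ⟨γ₃, a₃, b₃, -⟩, ⟨γ₄, a₄, b₄, -⟩⟩ :=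
      hPm 0 ⟨le_rfl, hT.le⟩
    rw [← b₄, a₄, ← b₃, a₃, ← b₂, a₂, ← b₁, a₁]
  -- With `x = t ^ 2`, the first-order quotient of `P √x` is the second-order quotient of the
  -- multi-flow.
  have key := isQDQ_of_eventually_quotient_mem (F := multiFlowSqrt Ω f g q)
    (G := fun x => P √x) (Λ := setLieBracket Ω f' g' q) (T := T ^ 2) (by positivity)
    (isCompact_setLieBracket Ω hfK hgK q)
    (hP.comp Real.continuous_sqrt.continuousOn hsqrt)
    (fun x hx => ⟨hx.1, multiFlow_mono hRΩ (hff.symm.mono hRΩ) (hgg.symm.mono hRΩ) _ _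
      (hPm _ (hsqrt x hx))⟩)
    (fun ε hε => by
      have hlim : Tendsto Real.sqrt (𝓝[>] 0) (𝓝[>] 0) :=
        tendsto_nhdsWithin_iff.2
          ⟨by simpa using (Real.continuous_sqrt.tendsto 0).mono_left nhdsWithin_le_nhds,
            eventually_mem_nhdsWithin.mono fun x hx => Real.sqrt_pos.2 hx⟩
      have ev := eventually_multiFlow_quotient_mem (Ω := Ω) (S := Metric.closedBall q R)
        (M := max Mf Mg) hfK hgK (fun z hz => (hMf z (hRΩ hz)).trans (le_max_left _ _))
        (fun z hz => (hMg z (hRΩ hz)).trans (le_max_right _ _))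
        (Metric.mem_closedBall_self hR.le) hq hε
      filter_upwards [hlim.eventually ev, self_mem_nhdsWithin,
        nhdsWithin_le_nhds (Iio_mem_nhds (by positivity : 0 < T ^ 2))] with x hx hx0 hxT
      have := hx _ (hPm _ (hsqrt x ⟨le_of_lt hx0, le_of_lt hxT⟩))
      rw [Real.sq_sqrt (le_of_lt hx0)] at this
      simpa [hP0] using this)
  simpa only [Real.sqrt_zero, hP0] using key
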